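/- Let $\beta\in(0,1)$ and let $(D_\tau)_{\tau\ge 0}$ be a $\beta$-stable subordinator on a probability space, i.e. a nondecreasing real Lévy process with $\mathbb{E}[e^{-sD_\tau}]=e^{-\tau s^\beta}$ for $s>0$. Let $E_t=\inf\{\tau>0: D_\tau>t\}$ be its inverse. Let $H:\mathbb{R}^d\to\mathbb{R}$ be convex with $H(p)/|p|\to+\infty$ as $|p|\to\infty$, let $L(q)=\sup_{p\in\mathbb{R}^d}\{p\cdot q-H(p)\}$ be its Legendre transform, and let $g:\mathbb{R}^d\to\mathbb{R}$ be bounded and Lipschitz continuous with Lipschitz constant $L_g$. Fix any filtration $(\mathcal{F}_s)_{s\ge0}$ on the probability space, and let $\mathcal{A}$ be the set of progressively measurable $\mathbb{R}^d$-valued controls $\alpha$. For $(x,t)\in\mathbb{R}^d\times(0,\infty)$ let $$u_\beta(x,t)=\inf_{\alpha\in\mathcal{A}}\mathbb{E}\left[\int_0^tL(\alpha(s))\,dE_s+g(X(0))\right],$$ where $X$ solves $dX(s)=\alpha(s)\,dE_s$, $X(t)=x$, i.e. $X(s)=x-\int_{(s,t]}\alpha(r)\,dE_r$ (pathwise Lebesgue–Stieltjes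 integrals; controls of cost $+\infty$ do not affect the infimum). Then this infimum is a real number for all $x\in\mathbb{R}^d$ and $t>0$, and: (i) for all $x,\bar x\in\mathbb{R}^d$ and $t\in(0,\infty)$, $|u_\beta(x,t)-u_\beta(\bar x,t)|\le L_g|x-\bar x|$; (ii) there is a constant $C$ such that for all $x\in\mathbb{R}^d$ and $t\in(0,\infty)$, $|u_\beta(x,t)-g(x)|\le Ct^\beta$; (iii) there is a constant $C$ such that for all $x\in\mathbb{R}^d$ and all $0<\bar t<t$, $|u_\beta(x,t)-u_\beta(x,\bar t)|\le C(t-\bar t)^\beta$. -/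

import Mathlib

open MeasureTheory ProbabilityTheory Filter Topology
open scoped NNReal ENNReal

noncomputable section

namespace FracHJ

/-- A stable subordinator of order `β`: a real Lévy process with almost surely nondecreasing,
right-continuous paths (left limits then exist by monotonicity) whose law at time `τ` has
Laplace transform `s ↦ exp (-τ s ^ β)`. -/
structure IsStableSubordinator {Ω : Type*} [MeasurableSpace Ω] (β : ℝ) (D : ℝ≥0 → Ω → ℝ)
    (P : Measure Ω) : Prop where
  measurable : ∀ τ, Measurable (D τ)
  zero : ∀ᵐ ω ∂P, D 0 ω = 0
  indep : HasIndepIncrements D P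
  stationary : ∀ σ τ : ℝ≥0, IdentDistrib (fun ω => D (σ + τ) ω - D σ ω) (D τ) P P
  mono : ∀ᵐ ω ∂P, Monotone fun τ => D τ ω
  rightCont : ∀ᵐ ω ∂P, ∀ τ : ℝ≥0, ContinuousWithinAt (fun σ => D σ ω) (Set.Ici τ) τ
  laplace : ∀ (τ : ℝ≥0) (s : ℝ), 0 < s →
    ∫ ω, Real.exp (-s * D τ ω) ∂P = Real.exp (-(τ : ℝ) * s ^ β)

/-- The first passage time `E_t = inf {τ > 0 : D_τ > t}`. -/
def inverse {Ω : Type*} (D : ℝ≥0 → Ω → ℝ) (t : ℝ) (ω : Ω) : ℝ :=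
  sInf {τ : ℝ | 0 < τ ∧ t < D τ.toNNReal ω}

open Classical in
/-- The Lebesgue–Stieltjes measure `dF` of a nondecreasing function `F`
(and `0` if `F` is not nondecreasing). -/
def stieltjesMeasure (F : ℝ → ℝ) : Measure ℝ :=
  if h : Monotone F then h.stieltjesFunction.measure else 0

/-- The random measure `dE_s` of the inverse process, on the path `ω`. It is the
Lebesgue–Stieltjes measure of `s ↦ E_s(ω)`; almost all of these paths are nondecreasing. -/
def dE {Ω : Type*} (D : ℝ≥0 → Ω → ℝ) (ω : Ω) : Measure ℝ :=
  stieltjesMeasure fun s => inverse D s ω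

/-- The Legendre transform `L(q) = sup_p {p · q - H(p)}`. -/
def legendre {d : ℕ} (H : EuclideanSpace ℝ (Fin d) → ℝ) (q : EuclideanSpace ℝ (Fin d)) : ℝ :=
  ⨆ p, (inner ℝ p q - H p)

/-- The controlled trajectory: the solution of `dX(s) = α(s) dE_s`, `X(t) = x`, that is
`X(s) = x - ∫_{(s,t]} α(r) dE_r`. -/
def state {Ω : Type*} {d : ℕ} (D : ℝ≥0 → Ω → ℝ) (x : EuclideanSpace ℝ (Fin d)) (t : ℝ)
    (α : ℝ≥0 → Ω → EuclideanSpace ℝ (Fin d)) (s : ℝ) (ω : Ω) : EuclideanSpace ℝ (Fin d) :=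
  x - ∫ r in Set.Ioc s t, α r.toNNReal ω ∂(dE D ω)

/-- `E[∫_0^t |L(α(s))| dE_s] < ∞`. As `L` is bounded below and superlinear, `E[E_t] < ∞`, and `g`
is bounded, a control violates this exactly when its cost is `+∞`, and a control satisfying it is
`dE_s`-integrable on `(0,t]` almost surely. -/
def FiniteCost {Ω : Type*} [MeasurableSpace Ω] {d : ℕ} (D : ℝ≥0 → Ω → ℝ) (P : Measure Ω)
    (L : EuclideanSpace ℝ (Fin d) → ℝ) (t : ℝ)
    (α : ℝ≥0 → Ω → EuclideanSpace ℝ (Fin d)) : Prop :=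
  ∫⁻ ω, ∫⁻ s in Set.Ioc 0 t, ‖L (α s.toNNReal ω)‖ₑ ∂(dE D ω) ∂P < ∞

/-- The cost functional `J(x,t,α) = E[∫_0^t L(α(s)) dE_s + g(X(0))]`. -/
def cost {Ω : Type*} [MeasurableSpace Ω] {d : ℕ} (D : ℝ≥0 → Ω → ℝ) (P : Measure Ω)
    (L g : EuclideanSpace ℝ (Fin d) → ℝ) (x : EuclideanSpace ℝ (Fin d)) (t : ℝ)
    (α : ℝ≥0 → Ω → EuclideanSpace ℝ (Fin d)) : ℝ :=
  ∫ ω, ((∫ s in Set.Ioc 0 t, L (α s.toNNReal ω) ∂(dE D ω)) + g (state D x t α 0 ω)) ∂P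

/-- The set of the finite values of the cost functional over all progressively measurable
controls. The value of a control at time `0` has no influence, since `dE_s` is integrated over
`(0,t]`. -/
def costSet {Ω : Type*} {mΩ : MeasurableSpace Ω} {d : ℕ} (D : ℝ≥0 → Ω → ℝ) (P : Measure Ω)
    (𝓕 : Filtration ℝ≥0 mΩ) (H g : EuclideanSpace ℝ (Fin d) → ℝ)
    (x : EuclideanSpace ℝ (Fin d)) (t : ℝ) : Set ℝ :=
  {c | ∃ α : ℝ≥0 → Ω → EuclideanSpace ℝ (Fin d), IsStronglyProgressive 𝓕 α ∧
    FiniteCost D P (legendre H) t α ∧ c = cost D P (legendre H) g x t α}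

/-- The value function `u_β(x,t) = inf_α J(x,t,α)` of the time-changed control problem. -/
def valueFunction {Ω : Type*} {mΩ : MeasurableSpace Ω} {d : ℕ} (D : ℝ≥0 → Ω → ℝ) (P : Measure Ω)
    (𝓕 : Filtration ℝ≥0 mΩ) (H g : EuclideanSpace ℝ (Fin d) → ℝ)
    (x : EuclideanSpace ℝ (Fin d)) (t : ℝ) : ℝ :=
  sInf (costSet D P 𝓕 H g x t)

end FracHJ

end

/-!
The value function is compared at two times `t' < t` by restricting and extending controls. A
control on `(0, t']` continued by `0` leaves the terminal state unchanged and adds the running cost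
`L 0` times the increment `E_t - E_{t'}` (`FiniteCost.cost_extendByZero`). Conversely, dropping the
part of a control on `(t', t]` changes the terminal state by at most `∫ |α| dE`, hence the terminal
cost by at most `Lg ∫ |α| dE`. Since `H` is finite, `L` is superlinear, so `L q ≥ Lg |q| - C`, and
the running cost on `(t', t]` makes up for this change except for `C (E_t - E_{t'})`
(`exists_le_legendre`, `FiniteCost.cost_restrict_le`). Both errors are controlled by the mean
`E[E_t - E_{t'}]`. The value function at time `0` is `g`, so the case `t' = 0` is the estimate
against `g`; it also shows that the infimum is finite. Translating the end point changes only the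
terminal cost, which gives the Lipschitz bound in space (`cost_le_cost_add`).

The mean of the inverse process is `E[E_t] = t ^ β E[E_1]`
(`IsStableSubordinator.integral_inverse`). By the layer cake formula `E[E_t]` is the integral over
`τ` of `P (D_τ ≤ t)`, and `D_τ / t` has the law of `D_{τ t^(-β)}`, because the two Laplace
transforms coincide and a law on the half-line is determined by its Laplace transform
(`measure_le_eq_of_laplace_eq`). Markov's inequality for `exp (-D_τ)` shows that `E[E_1]` is finite,
and subadditivity of `t ^ β` bounds the mean increment by a multiple of `(t - t') ^ β`
(`IsStableSubordinator.integral_inverse_sub_le`).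

All costs are Bochner integrals over the probability space, so measurability has to be known before
they can be compared. Off a null set of paths the random measure `dE` on `(0, T]` is an s-finite
kernel (`IsStableSubordinator.exists_kernel`), and a progressively measurable control agrees on
`(0, T]` with a jointly measurable function (`exists_jointly_stronglyMeasurable`).
-/

namespace FracHJ

/-! ### The Legendre transform -/

section Legendre

variable {d : ℕ} {H : EuclideanSpace ℝ (Fin d) → ℝ}

lemma continuous_of_convexOn_univ (hH : ConvexOn ℝ Set.univ H) : Continuous H :=
  hH.locallyLipschitz.continuous

lemma bddAbove_range_inner_sub (hH : ConvexOn ℝ Set.univ H)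
    (hsup : Tendsto (fun p => H p / ‖p‖) (Bornology.cobounded _) atTop)
    (q : EuclideanSpace ℝ (Fin d)) : BddAbove (Set.range fun p => inner ℝ p q - H p) := by
  have hcont : Continuous fun p => inner ℝ p q - H p :=
    (continuous_id.inner continuous_const).sub (continuous_of_convexOn_univ hH)
  have hev : {p | ‖q‖ ≤ H p / ‖p‖} ∈ Bornology.cobounded _ := hsup.eventually_ge_atTop ‖q‖
  have hbdd : Bornology.IsBounded {p | ‖q‖ ≤ H p / ‖p‖}ᶜ := by
    rwa [Bornology.isBounded_def, compl_compl]
  obtain ⟨r, hr⟩ := hbdd.subset_closedBall 0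
  obtain ⟨C, hC⟩ :=
    (isCompact_closedBall (0 : EuclideanSpace ℝ (Fin d)) r).bddAbove_image hcont.continuousOn
  -- The point `0` is treated apart, since there the junk value `H 0 / ‖0‖ = 0` says nothing.
  refine ⟨max C (max 0 (-H 0)), ?_⟩
  rintro _ ⟨p, rfl⟩
  by_cases hp : ‖q‖ ≤ H p / ‖p‖
  · rcases eq_or_ne p 0 with rfl | hp0
    · simp
    · have h1 : ‖q‖ * ‖p‖ ≤ H p := (le_div_iff₀ (norm_pos_iff.2 hp0)).1 hp
      have h2 := real_inner_le_norm p q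
      refine le_max_of_le_right (le_max_of_le_left ?_)
      dsimp only
      linarith [mul_comm ‖p‖ ‖q‖]
  · exact le_max_of_le_left (hC ⟨p, hr hp, rfl⟩)

/-- The Legendre transform of a finite superlinear convex function grows faster than any linear
function, because the convex function is bounded on every ball. -/
lemma exists_le_legendre (hH : ConvexOn ℝ Set.univ H)
    (hsup : Tendsto (fun p => H p / ‖p‖) (Bornology.cobounded _) atTop) (R : ℝ) (hR : 0 ≤ R) :
    ∃ C : ℝ, 0 ≤ C ∧ ∀ q, R * ‖q‖ - C ≤ legendre H q := by
  obtain ⟨C, hC⟩ := (isCompact_closedBall (0 : EuclideanSpace ℝ (Fin d)) R).bddAbove_image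
    (continuous_of_convexOn_univ hH).continuousOn
  refine ⟨max C 0, le_max_right _ _, fun q => ?_⟩
  have hle : ∀ p, inner ℝ p q - H p ≤ legendre H q :=
    fun p => le_ciSup (bddAbove_range_inner_sub hH hsup q) p
  rcases eq_or_ne q 0 with rfl | hq
  · have h0 : H 0 ≤ C := hC ⟨0, by simpa using hR, rfl⟩
    have := hle 0
    simp only [inner_zero_right, norm_zero, mul_zero] at this ⊢
    linarith [le_max_left C 0]
  · have hq' : ‖q‖ ≠ 0 := norm_ne_zero_iff.2 hq
    -- Test the supremum at the point of norm `R` in the direction of `q`.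
    have hn : ‖(R / ‖q‖) • q‖ = R := by
      rw [norm_smul, Real.norm_of_nonneg (by positivity), div_mul_cancel₀ _ hq']
    have h0 : H ((R / ‖q‖) • q) ≤ C := hC ⟨_, by simp [hn], rfl⟩
    have h1 := hle ((R / ‖q‖) • q)
    rw [real_inner_smul_left, real_inner_self_eq_norm_sq] at h1
    have h2 : R / ‖q‖ * ‖q‖ ^ 2 = R * ‖q‖ := by field_simp
    linarith [le_max_left C 0]

lemma measurable_legendre (hH : ConvexOn ℝ Set.univ H)
    (hsup : Tendsto (fun p => H p / ‖p‖) (Bornology.cobounded _) atTop) :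
    Measurable (legendre H) :=
  (lowerSemicontinuous_ciSup (bddAbove_range_inner_sub hH hsup) fun _ =>
    ((continuous_const.inner continuous_id).sub continuous_const).lowerSemicontinuous).measurable

end Legendre

/-! ### Uniqueness of the Laplace transform on the half-line -/

/-- A finite measure on `[0, ∞)` is determined by its Laplace transform at the natural numbers:
the polynomials in `x ↦ exp (-x)` form an algebra of bounded functions separating points. -/
lemma ext_of_integral_exp_neg_nat {μ ν : Measure ℝ≥0} [IsFiniteMeasure μ] [IsFiniteMeasure ν]
    (h : ∀ n : ℕ, ∫ x : ℝ≥0, Real.exp (-n * x) ∂μ = ∫ x : ℝ≥0, Real.exp (-n * x) ∂ν) : μ = ν := by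
  let φ : BoundedContinuousFunction ℝ≥0 ℝ := BoundedContinuousFunction.ofNormedAddCommGroup
    (fun x : ℝ≥0 => Real.exp (-x)) (by fun_prop) 1 fun x => by simp [Real.abs_exp]
  let A : StarSubalgebra ℝ (BoundedContinuousFunction ℝ≥0 ℝ) :=
    { Algebra.adjoin ℝ {φ} with
      star_mem' := fun {f} hf => by
        have : star f = f := by ext x; simp
        rw [this]; exact hf }
  refine ext_of_forall_mem_subalgebra_integral_eq_of_pseudoEMetric_complete_countable
    (𝕜 := ℝ) (A := A) ?_ ?_
  · intro x y hxy
    refine ⟨φ, ⟨φ.toContinuousMap, ⟨φ, Algebra.self_mem_adjoin_singleton ℝ φ, rfl⟩, rfl⟩, ?_⟩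
    intro he
    have he' : Real.exp (-x) = Real.exp (-y) := he
    exact hxy (by simpa using he')
  · intro f hf
    have hf' : f ∈ Algebra.adjoin ℝ {φ} := hf
    rw [Algebra.adjoin_singleton_eq_range_aeval] at hf'
    obtain ⟨p, rfl⟩ := hf'
    have key : ∀ (ρ : Measure ℝ≥0) [IsFiniteMeasure ρ],
        ∫ x, (Polynomial.aeval φ p : BoundedContinuousFunction ℝ≥0 ℝ) x ∂ρ =
          p.sum fun n a => a * ∫ x : ℝ≥0, Real.exp (-n * x) ∂ρ := by
      intro ρ _
      have hφ : ∀ n : ℕ, ∀ x : ℝ≥0, (φ ^ n) x = Real.exp (-n * x) := by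
        intro n x
        rw [BoundedContinuousFunction.pow_apply]
        change Real.exp (-x) ^ n = _
        rw [← Real.exp_nat_mul]; ring_nf
      simp_rw [Polynomial.aeval_eq_sum_range, Polynomial.sum_over_range' p (f := fun n a =>
        a * ∫ x : ℝ≥0, Real.exp (-n * x) ∂ρ) (by simp) (p.natDegree + 1) (by simp),
        BoundedContinuousFunction.sum_apply, BoundedContinuousFunction.smul_apply, smul_eq_mul]
      rw [integral_finsetSum]
      · simp_rw [integral_const_mul, hφ]
      · exact fun n _ => ((φ ^ n).integrable ρ).const_mul _
    change ∫ x, (Polynomial.aeval φ p : BoundedContinuousFunction ℝ≥0 ℝ) x ∂μ =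
      ∫ x, (Polynomial.aeval φ p : BoundedContinuousFunction ℝ≥0 ℝ) x ∂ν
    rw [key, key]
    simp_rw [h]

/-- Almost surely nonnegative random variables with the same Laplace transform have the same
distribution function. -/
lemma measure_le_eq_of_laplace_eq {Ω : Type*} [MeasurableSpace Ω] {P : Measure Ω}
    [IsProbabilityMeasure P]
    {X Y : Ω → ℝ} (hX : Measurable X) (hY : Measurable Y) (hX0 : ∀ᵐ ω ∂P, 0 ≤ X ω)
    (hY0 : ∀ᵐ ω ∂P, 0 ≤ Y ω)
    (h : ∀ s : ℝ, 0 < s → ∫ ω, Real.exp (-s * X ω) ∂P = ∫ ω, Real.exp (-s * Y ω) ∂P) (t : ℝ)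
    (ht : 0 ≤ t) : P {ω | X ω ≤ t} = P {ω | Y ω ≤ t} := by
  have hm : ∀ Z : Ω → ℝ, Measurable Z → Measurable fun ω => (Z ω).toNNReal :=
    fun Z hZ => hZ.real_toNNReal
  have hlap : ∀ Z : Ω → ℝ, Measurable Z → (∀ᵐ ω ∂P, 0 ≤ Z ω) → ∀ n : ℕ,
      ∫ x : ℝ≥0, Real.exp (-n * x) ∂(P.map fun ω => (Z ω).toNNReal) =
        ∫ ω, Real.exp (-n * Z ω) ∂P := by
    intro Z hZ hZ0 n
    rw [integral_map (hm Z hZ).aemeasurable (by fun_prop)]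
    refine integral_congr_ae ?_
    filter_upwards [hZ0] with ω hω
    rw [Real.coe_toNNReal _ hω]
  have hlaw : P.map (fun ω => (X ω).toNNReal) = P.map (fun ω => (Y ω).toNNReal) := by
    refine ext_of_integral_exp_neg_nat fun n => ?_
    rw [hlap X hX hX0, hlap Y hY hY0]
    rcases Nat.eq_zero_or_pos n with rfl | hn
    · simp
    · exact h n (by exact_mod_cast hn)
  have hset : ∀ Z : Ω → ℝ, Measurable Z →
      P {ω | Z ω ≤ t} = P.map (fun ω => (Z ω).toNNReal) (Set.Iic t.toNNReal) := by
    intro Z hZ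
    rw [Measure.map_apply (hm Z hZ) measurableSet_Iic]
    congr 1
    ext ω
    simp [Real.toNNReal_le_toNNReal_iff ht]
  rw [hset X hX, hset Y hY, hlaw]

/-! ### Paths of the inverse process -/

/-- The regularity of the path `D · ω` that makes its first passage times `E_t` finite and
nondecreasing in `t`. -/
structure IsGoodPath {Ω : Type*} (D : ℝ≥0 → Ω → ℝ) (ω : Ω) : Prop where
  zero : D 0 ω = 0
  mono : Monotone fun τ => D τ ω
  unbounded : ∀ n : ℕ, ∃ k : ℕ, (n : ℝ) < D k ω

section Path

variable {Ω : Type*} {D : ℝ≥0 → Ω → ℝ} {ω : Ω}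

lemma bddBelow_passage (t : ℝ) : BddBelow {τ : ℝ | 0 < τ ∧ t < D τ.toNNReal ω} :=
  ⟨0, fun _ h => h.1.le⟩

lemma inverse_nonneg (t : ℝ) : 0 ≤ inverse D t ω :=
  Real.sInf_nonneg fun _ h => h.1.le

lemma inverse_le {t τ : ℝ} (hτ : 0 < τ) (h : t < D τ.toNNReal ω) : inverse D t ω ≤ τ :=
  csInf_le (bddBelow_passage t) ⟨hτ, h⟩

namespace IsGoodPath

lemma nonempty_passage (h : IsGoodPath D ω) (t : ℝ) :
    {τ : ℝ | 0 < τ ∧ t < D τ.toNNReal ω}.Nonempty := by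
  obtain ⟨n, hn⟩ := exists_nat_gt t
  obtain ⟨k, hk⟩ := h.unbounded n
  refine ⟨k + 1, by positivity, (hn.trans hk).trans_le (h.mono ?_)⟩
  rw [Real.le_toNNReal_iff_coe_le (by positivity)]
  simp

/-- Rational times suffice, which makes `E_t` measurable. -/
lemma inverse_lt_iff (h : IsGoodPath D ω) {t c : ℝ} :
    inverse D t ω < c ↔ ∃ q : ℚ, 0 < (q : ℝ) ∧ (q : ℝ) < c ∧ t < D (q : ℝ).toNNReal ω := by
  constructor
  · intro hc
    obtain ⟨τ, ⟨hτ0, hτ⟩, hτc⟩ := exists_lt_of_csInf_lt (h.nonempty_passage t) hc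
    obtain ⟨q, hq1, hq2⟩ := exists_rat_btwn hτc
    exact ⟨q, hτ0.trans hq1, hq2, hτ.trans_le (h.mono (Real.toNNReal_le_toNNReal hq1.le))⟩
  · rintro ⟨q, hq0, hqc, hq⟩
    exact (inverse_le hq0 hq).trans_lt hqc

lemma monotone_inverse (h : IsGoodPath D ω) : Monotone fun t => inverse D t ω :=
  fun _ t hst => csInf_le_csInf (bddBelow_passage _) (h.nonempty_passage t)
    fun _ hτ => ⟨hτ.1, hst.trans_lt hτ.2⟩

/-- The strict inequality in the definition of `E_t` makes it right-continuous in `t`. -/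
lemma rightLim_inverse (h : IsGoodPath D ω) (t : ℝ) :
    Function.rightLim (fun s => inverse D s ω) t = inverse D t ω := by
  refine le_antisymm (le_of_forall_gt fun c hc => ?_) (h.monotone_inverse.le_rightLim le_rfl)
  obtain ⟨τ, ⟨hτ0, hτ⟩, hτc⟩ := exists_lt_of_csInf_lt (h.nonempty_passage t) hc
  obtain ⟨u, hu1, hu2⟩ := exists_between hτ
  exact ((h.monotone_inverse.rightLim_le hu1).trans (inverse_le hτ0 hu2)).trans_lt hτc

lemma dE_Ioc (h : IsGoodPath D ω) (a b : ℝ) :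
    dE D ω (Set.Ioc a b) = ENNReal.ofReal (inverse D b ω - inverse D a ω) := by
  rw [dE, stieltjesMeasure, dif_pos h.monotone_inverse, StieltjesFunction.measure_Ioc,
    Monotone.stieltjesFunction_eq, Monotone.stieltjesFunction_eq, h.rightLim_inverse,
    h.rightLim_inverse]

lemma le_of_lt_inverse {t : ℝ} {τ : ℝ} (hτ : 0 < τ) (h : τ < inverse D t ω) :
    D τ.toNNReal ω ≤ t :=
  not_lt.1 fun h' => (inverse_le hτ h').not_gt h

lemma le_inverse_of_le (h : IsGoodPath D ω) {t : ℝ} {τ : ℝ} (hle : D τ.toNNReal ω ≤ t) :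
    τ ≤ inverse D t ω := by
  refine le_csInf (h.nonempty_passage t) fun σ hσ => ?_
  by_contra! hlt
  exact (hσ.2.trans_le (h.mono (Real.toNNReal_le_toNNReal hlt.le))).not_ge hle

end IsGoodPath

end Path

/-! ### Moments of the inverse process -/

namespace IsStableSubordinator

variable {Ω : Type*} [MeasurableSpace Ω] {P : Measure Ω} [IsProbabilityMeasure P] {β : ℝ}
  {D : ℝ≥0 → Ω → ℝ}

omit [IsProbabilityMeasure P] in
lemma ae_nonneg (hD : IsStableSubordinator β D P) (τ : ℝ≥0) : ∀ᵐ ω ∂P, 0 ≤ D τ ω := by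
  filter_upwards [hD.zero, hD.mono] with ω h0 hm
  rw [← h0]
  exact hm zero_le

lemma integrable_exp (hD : IsStableSubordinator β D P) (τ : ℝ≥0) {s : ℝ} (hs : 0 < s) :
    Integrable (fun ω => Real.exp (-s * D τ ω)) P := by
  refine Integrable.of_bound ((hD.measurable τ).const_mul (-s)).exp.aestronglyMeasurable 1 ?_
  filter_upwards [hD.ae_nonneg τ] with ω hω
  rw [Real.norm_of_nonneg (Real.exp_nonneg _), Real.exp_le_one_iff]
  nlinarith

/-- Markov's inequality for `exp (-D_τ)`. -/
lemma measure_le_le (hD : IsStableSubordinator β D P) (τ : ℝ≥0) (t : ℝ) :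
    P {ω | D τ ω ≤ t} ≤ ENNReal.ofReal (Real.exp (t - τ)) := by
  have h1 := mul_meas_ge_le_integral_of_nonneg (ae_of_all P fun ω => Real.exp_nonneg (-1 * D τ ω))
    (hD.integrable_exp τ one_pos) (Real.exp (-t))
  rw [hD.laplace τ 1 one_pos, Real.one_rpow, mul_one] at h1
  have h2 : {ω | Real.exp (-t) ≤ Real.exp (-1 * D τ ω)} = {ω | D τ ω ≤ t} := by
    ext ω; simp
  rw [h2] at h1
  rw [← ENNReal.ofReal_toReal (measure_ne_top P {ω | D τ ω ≤ t})]
  refine ENNReal.ofReal_le_ofReal ?_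
  have h3 : Real.exp (t - τ) = Real.exp t * Real.exp (-τ) := by rw [← Real.exp_add]; ring_nf
  have h4 : Real.exp t * Real.exp (-t) = 1 := by rw [← Real.exp_add]; simp
  rw [h3]
  calc P.real {ω | D τ ω ≤ t} = Real.exp t * (Real.exp (-t) * P.real {ω | D τ ω ≤ t}) := by
        rw [← mul_assoc, h4, one_mul]
    _ ≤ _ := by gcongr

lemma ae_isGoodPath (hD : IsStableSubordinator β D P) : ∀ᵐ ω ∂P, IsGoodPath D ω := by
  have hunb : ∀ᵐ ω ∂P, ∀ n : ℕ, ∃ k : ℕ, (n : ℝ) < D k ω := by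
    rw [ae_all_iff]
    intro n
    rw [ae_iff]
    refine le_antisymm (ge_of_tendsto' (x := atTop)
      (f := fun k : ℕ => ENNReal.ofReal (Real.exp (n - k))) ?_ fun k => ?_) zero_le
    · rw [← ENNReal.ofReal_zero]
      refine ENNReal.tendsto_ofReal (Real.tendsto_exp_atBot.comp ?_)
      exact tendsto_atBot_add_const_left _ _
        (tendsto_neg_atTop_atBot.comp tendsto_natCast_atTop_atTop)
    · refine (measure_mono fun ω hω => ?_).trans (hD.measure_le_le k n)
      exact not_lt.1 fun h => hω ⟨k, h⟩
  filter_upwards [hD.zero, hD.mono, hunb] with ω h0 hm hu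
  exact ⟨h0, hm, hu⟩

/-- There is a measurable set of full measure on which all paths are good. -/
lemma exists_measurableSet_isGoodPath (hD : IsStableSubordinator β D P) :
    ∃ G : Set Ω, MeasurableSet G ∧ (∀ᵐ ω ∂P, ω ∈ G) ∧ ∀ ω ∈ G, IsGoodPath D ω := by
  obtain ⟨s, hs, hsm, hs0⟩ := exists_measurable_superset_of_null (ae_iff.1 hD.ae_isGoodPath)
  refine ⟨sᶜ, hsm.compl, measure_eq_zero_iff_ae_notMem.1 hs0, fun ω hω => ?_⟩
  by_contra h
  exact hω (hs h)

omit [IsProbabilityMeasure P] in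
lemma measurable_indicator_inverse (hD : IsStableSubordinator β D P) {G : Set Ω}
    (hGm : MeasurableSet G) (hG : ∀ ω ∈ G, IsGoodPath D ω) (t : ℝ) :
    Measurable (G.indicator fun ω => inverse D t ω) := by
  refine measurable_of_Iio fun c => ?_
  rcases le_or_gt c 0 with hc | hc
  · convert MeasurableSet.empty
    ext ω
    simp only [Set.mem_preimage, Set.mem_Iio, Set.mem_empty_iff_false, iff_false, not_lt]
    exact hc.trans (Set.indicator_nonneg (fun ω _ => inverse_nonneg t) ω)
  · have : (G.indicator fun ω => inverse D t ω) ⁻¹' Set.Iio c =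
        Gᶜ ∪ ⋃ q : ℚ, {ω | 0 < (q : ℝ) ∧ (q : ℝ) < c} ∩ {ω | t < D (q : ℝ).toNNReal ω} := by
      ext ω
      by_cases hω : ω ∈ G
      · simp [hω, (hG ω hω).inverse_lt_iff, and_assoc]
      · simp [hω, hc]
    rw [this]
    exact hGm.compl.union (MeasurableSet.iUnion fun q => (MeasurableSet.const _).inter
      (measurableSet_lt measurable_const (hD.measurable _)))

lemma aemeasurable_inverse (hD : IsStableSubordinator β D P) (t : ℝ) :
    AEMeasurable (fun ω => inverse D t ω) P := by
  obtain ⟨G, hGm, hGae, hG⟩ := hD.exists_measurableSet_isGoodPath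
  refine ⟨_, hD.measurable_indicator_inverse hGm hG t, ?_⟩
  filter_upwards [hGae] with ω hω
  rw [Set.indicator_of_mem hω]

/-- Self-similarity of the one-dimensional marginals: `D_τ / t` has the law of `D_{τ t^(-β)}`. -/
lemma measure_le_eq (hD : IsStableSubordinator β D P) {t : ℝ} (ht : 0 < t) {τ σ : ℝ≥0}
    (hσ : (τ : ℝ) = t ^ β * σ) :
    P {ω | D τ ω ≤ t} = P {ω | D σ ω ≤ 1} := by
  have h := measure_le_eq_of_laplace_eq (P := P) (X := fun ω => D τ ω / t) (Y := D σ)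
    ((hD.measurable τ).div_const t) (hD.measurable σ)
    ((hD.ae_nonneg τ).mono fun ω hω => div_nonneg hω ht.le) (hD.ae_nonneg σ) ?_ 1 zero_le_one
  · rw [← h]
    simp_rw [div_le_one ht]
  · intro s hs
    have hst : 0 < s / t := div_pos hs ht
    have h1 : ∀ ω, -s * (D τ ω / t) = -(s / t) * D τ ω := fun ω => by ring
    simp_rw [h1]
    rw [hD.laplace τ _ hst, hD.laplace σ s hs, hσ, Real.div_rpow hs.le ht.le]
    congr 1
    have : t ^ β ≠ 0 := (Real.rpow_pos_of_pos ht β).ne'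
    field_simp

/-- The layer cake formula for `E_t`, with the events `{τ < E_t}` replaced by `{D_τ ≤ t}`; they
agree up to a null set for almost every `τ`. -/
lemma lintegral_inverse (hD : IsStableSubordinator β D P) (t : ℝ) :
    ∫⁻ ω, ENNReal.ofReal (inverse D t ω) ∂P =
      ∫⁻ τ : ℝ in Set.Ioi 0, P {ω | D τ.toNNReal ω ≤ t} := by
  have h0 : 0 ≤ᵐ[P] fun ω => inverse D t ω := ae_of_all _ fun ω => inverse_nonneg t
  refine le_antisymm ?_ ?_
  · rw [lintegral_eq_lintegral_meas_lt P h0 (hD.aemeasurable_inverse t)]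
    refine setLIntegral_mono' measurableSet_Ioi fun τ hτ => measure_mono fun ω hω => ?_
    exact IsGoodPath.le_of_lt_inverse hτ hω
  · rw [lintegral_eq_lintegral_meas_le P h0 (hD.aemeasurable_inverse t)]
    refine lintegral_mono fun τ => measure_mono_ae ?_
    filter_upwards [hD.ae_isGoodPath] with ω hω h
    exact hω.le_inverse_of_le h

lemma lintegral_inverse_one_lt_top (hD : IsStableSubordinator β D P) :
    ∫⁻ ω, ENNReal.ofReal (inverse D 1 ω) ∂P < ∞ := by
  rw [hD.lintegral_inverse]
  have hint : IntegrableOn (fun τ : ℝ => Real.exp 1 * Real.exp (-τ)) (Set.Ioi 0) :=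
    (integrableOn_exp_neg_Ioi 0).const_mul _
  refine (setLIntegral_mono' measurableSet_Ioi fun τ (hτ : 0 < τ) => ?_).trans_lt
    hint.lintegral_lt_top
  refine (hD.measure_le_le _ _).trans_eq ?_
  rw [Real.coe_toNNReal _ hτ.le, ← Real.exp_add, sub_eq_add_neg]

lemma lintegral_inverse_eq (hD : IsStableSubordinator β D P) {t : ℝ} (ht : 0 < t) :
    ∫⁻ ω, ENNReal.ofReal (inverse D t ω) ∂P =
      ∫⁻ ω, ENNReal.ofReal (t ^ β * inverse D 1 ω) ∂P := by
  have htβ : 0 < t ^ β := Real.rpow_pos_of_pos ht β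
  have h0 : 0 ≤ᵐ[P] fun ω => t ^ β * inverse D 1 ω :=
    ae_of_all _ fun ω => mul_nonneg htβ.le (inverse_nonneg 1)
  have hm : AEMeasurable (fun ω => t ^ β * inverse D 1 ω) P :=
    (hD.aemeasurable_inverse 1).const_mul _
  have hscale : ∀ τ : ℝ, 0 < τ →
      P {ω | D τ.toNNReal ω ≤ t} = P {ω | D (τ / t ^ β).toNNReal ω ≤ 1} := fun τ hτ => by
    refine hD.measure_le_eq ht ?_
    rw [Real.coe_toNNReal _ hτ.le, Real.coe_toNNReal _ (by positivity),
      mul_div_cancel₀ _ htβ.ne']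
  rw [hD.lintegral_inverse]
  refine le_antisymm ?_ ?_
  · rw [lintegral_eq_lintegral_meas_le P h0 hm]
    refine setLIntegral_mono' measurableSet_Ioi fun τ hτ => ?_
    rw [hscale τ hτ]
    refine measure_mono_ae ?_
    filter_upwards [hD.ae_isGoodPath] with ω hω h
    exact (div_le_iff₀' htβ).1 (hω.le_inverse_of_le h)
  · rw [lintegral_eq_lintegral_meas_lt P h0 hm]
    refine setLIntegral_mono' measurableSet_Ioi fun τ hτ => ?_
    rw [hscale τ hτ]
    refine measure_mono fun ω hω => ?_
    exact IsGoodPath.le_of_lt_inverse (div_pos hτ htβ) ((div_lt_iff₀' htβ).2 hω)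

lemma integrable_inverse (hD : IsStableSubordinator β D P) (t : ℝ) :
    Integrable (fun ω => inverse D t ω) P := by
  have hone : Integrable (fun ω => inverse D 1 ω) P :=
    (lintegral_ofReal_ne_top_iff_integrable (hD.aemeasurable_inverse 1).aestronglyMeasurable
      (ae_of_all _ fun ω => inverse_nonneg 1)).1 hD.lintegral_inverse_one_lt_top.ne
  have hpos : ∀ t : ℝ, 0 < t → Integrable (fun ω => inverse D t ω) P := fun t ht => by
    refine (lintegral_ofReal_ne_top_iff_integrable
      (hD.aemeasurable_inverse t).aestronglyMeasurable
      (ae_of_all _ fun ω => inverse_nonneg t)).1 ?_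
    rw [hD.lintegral_inverse_eq ht]
    exact (hone.const_mul _).lintegral_lt_top.ne
  refine (hpos (max t 1) (by positivity)).mono'
    (hD.aemeasurable_inverse t).aestronglyMeasurable ?_
  filter_upwards [hD.ae_isGoodPath] with ω hω
  rw [Real.norm_of_nonneg (inverse_nonneg t)]
  exact hω.monotone_inverse (le_max_left _ _)

lemma integral_inverse (hD : IsStableSubordinator β D P) {t : ℝ} (ht : 0 < t) :
    ∫ ω, inverse D t ω ∂P = t ^ β * ∫ ω, inverse D 1 ω ∂P := by
  have htβ : 0 < t ^ β := Real.rpow_pos_of_pos ht β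
  rw [← integral_const_mul, integral_eq_lintegral_of_nonneg_ae
    (ae_of_all _ fun ω => inverse_nonneg t) (hD.integrable_inverse t).aestronglyMeasurable,
    hD.lintegral_inverse_eq ht, ← integral_eq_lintegral_of_nonneg_ae
    (ae_of_all _ fun ω => mul_nonneg htβ.le (inverse_nonneg 1))
    ((hD.integrable_inverse 1).const_mul _).aestronglyMeasurable]

/-- The expected increment of the inverse is `β`-Hölder: `E[E_t]` is a multiple of the concave
function `t ^ β`. -/
lemma integral_inverse_sub_le (hD : IsStableSubordinator β D P) (hβ0 : 0 < β) (hβ1 : β < 1)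
    {t' t : ℝ} (ht' : 0 ≤ t') (htt' : t' < t) :
    ∫ ω, (inverse D t ω - inverse D t' ω) ∂P ≤ (∫ ω, inverse D 1 ω ∂P) * (t - t') ^ β := by
  have hm : 0 ≤ ∫ ω, inverse D 1 ω ∂P := integral_nonneg fun ω => inverse_nonneg 1
  rw [integral_sub (hD.integrable_inverse t) (hD.integrable_inverse t'),
    hD.integral_inverse (ht'.trans_lt htt')]
  have hlow : t' ^ β * ∫ ω, inverse D 1 ω ∂P ≤ ∫ ω, inverse D t' ω ∂P := by
    rcases ht'.eq_or_lt with rfl | hpos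
    · rw [Real.zero_rpow hβ0.ne', zero_mul]
      exact integral_nonneg fun ω => inverse_nonneg 0
    · exact (hD.integral_inverse hpos).ge
  -- Subadditivity of the concave power `β`.
  have hsub : t ^ β ≤ (t - t') ^ β + t' ^ β := by
    simpa using Real.rpow_add_le_add_rpow (sub_nonneg.2 htt'.le) ht' hβ0.le hβ1.le
  nlinarith

end IsStableSubordinator

/-! ### Measurability of integrals against the random measure -/

/-- A kernel all of whose measures are finite is s-finite: cut its domain along the integer part
of the total mass. -/
lemma isSFiniteKernel_of_isFiniteMeasure {X Y : Type*} [MeasurableSpace X] [MeasurableSpace Y]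
    (κ : Kernel X Y) [∀ a, IsFiniteMeasure (κ a)] : IsSFiniteKernel κ := by
  have hmass : Measurable fun a => ⌊(κ a Set.univ).toReal⌋₊ :=
    Nat.measurable_floor.comp (κ.measurable_coe MeasurableSet.univ).ennreal_toReal
  have hs : ∀ n : ℕ, MeasurableSet {a | ⌊(κ a Set.univ).toReal⌋₊ = n} :=
    fun n => hmass (measurableSet_singleton n)
  classical
  refine ⟨fun n => Kernel.piecewise (hs n) κ 0, fun n => ⟨n + 1, by finiteness, fun a => ?_⟩, ?_⟩
  · rw [Kernel.piecewise_apply']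
    split_ifs with h
    · have h1 : (κ a Set.univ).toReal < n + 1 := by
        have := Nat.lt_floor_add_one (κ a Set.univ).toReal
        rwa [show ⌊(κ a Set.univ).toReal⌋₊ = n from h] at this
      rw [← ENNReal.ofReal_toReal (measure_ne_top (κ a) Set.univ)]
      refine (ENNReal.ofReal_le_ofReal h1.le).trans_eq ?_
      rw [ENNReal.ofReal_add (by positivity) zero_le_one]
      simp
    · simp
  · ext a s hs'
    rw [Kernel.sum_apply' _ _ hs', tsum_eq_single ⌊(κ a Set.univ).toReal⌋₊]
    · rw [Kernel.piecewise_apply']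
      simp
    · intro n hn
      rw [Kernel.piecewise_apply']
      simp [hn.symm]

section Measurability

variable {Ω : Type*} {mΩ : MeasurableSpace Ω} {P : Measure Ω} [IsProbabilityMeasure P] {β : ℝ}
  {D : ℝ≥0 → Ω → ℝ}

namespace IsGoodPath

lemma isFiniteMeasure_restrict {ω : Ω} (h : IsGoodPath D ω) (a b : ℝ) :
    IsFiniteMeasure ((dE D ω).restrict (Set.Ioc a b)) :=
  ⟨by rw [Measure.restrict_apply_univ, h.dE_Ioc]; exact ENNReal.ofReal_lt_top⟩

lemma real_dE_Ioc {ω : Ω} (h : IsGoodPath D ω) {a b : ℝ} (hab : a ≤ b) :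
    (dE D ω).real (Set.Ioc a b) = inverse D b ω - inverse D a ω := by
  rw [measureReal_def, h.dE_Ioc, ENNReal.toReal_ofReal (sub_nonneg.2 (h.monotone_inverse hab))]

end IsGoodPath

/-- Up to a null set of paths, the random measure on a bounded interval is a transition kernel. -/
lemma IsStableSubordinator.exists_kernel (hD : IsStableSubordinator β D P) (T : ℝ) :
    ∃ κ : Kernel Ω ℝ, IsSFiniteKernel κ ∧
      ∀ᵐ ω ∂P, κ ω = (dE D ω).restrict (Set.Ioc 0 T) := by
  classical
  obtain ⟨G, hGm, hGae, hG⟩ := hD.exists_measurableSet_isGoodPath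
  let μ : Ω → Measure ℝ := fun ω => if ω ∈ G then (dE D ω).restrict (Set.Ioc 0 T) else 0
  have hμfin : ∀ ω, IsFiniteMeasure (μ ω) := fun ω => by
    by_cases hω : ω ∈ G
    · simpa only [μ, if_pos hω] using (hG ω hω).isFiniteMeasure_restrict 0 T
    · simp only [μ, if_neg hω]; infer_instance
  have hIoc : ∀ b : ℝ, Measurable fun ω =>
      ENNReal.ofReal (G.indicator (fun ω => inverse D b ω) ω -
        G.indicator (fun ω => inverse D 0 ω) ω) := fun b =>
    ((hD.measurable_indicator_inverse hGm hG b).sub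
      (hD.measurable_indicator_inverse hGm hG 0)).ennreal_ofReal
  have hμIoc : ∀ ω b, (if ω ∈ G then dE D ω (Set.Ioc 0 b) else 0) =
      ENNReal.ofReal (G.indicator (fun ω => inverse D b ω) ω -
        G.indicator (fun ω => inverse D 0 ω) ω) := fun ω b => by
    by_cases hω : ω ∈ G
    · simp [hω, (hG ω hω).dE_Ioc]
    · simp [hω]
  have hμm : Measurable μ := by
    refine Measurable.measure_of_isPiSystem (S := Set.range Set.Iic)
      (borel_eq_generateFrom_Iic ℝ ▸ BorelSpace.measurable_eq) isPiSystem_Iic ?_ ?_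
    · rintro _ ⟨a, rfl⟩
      convert hIoc (min T a) using 2 with ω
      rw [← hμIoc]
      by_cases hω : ω ∈ G
      · simp only [μ, if_pos hω]
        rw [Measure.restrict_apply measurableSet_Iic, Set.inter_comm, Set.Ioc_inter_Iic]
      · simp [μ, hω]
    · convert hIoc T using 2 with ω
      rw [← hμIoc]
      by_cases hω : ω ∈ G
      · simp [μ, hω]
      · simp [μ, hω]
  let κ : Kernel Ω ℝ := ⟨μ, hμm⟩
  have : ∀ ω, IsFiniteMeasure (κ ω) := hμfin
  refine ⟨κ, isSFiniteKernel_of_isFiniteMeasure κ, ?_⟩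
  filter_upwards [hGae] with ω hω
  change μ ω = _
  simp only [μ, if_pos hω]

/-- On `(0, T]` a progressively measurable process agrees with a jointly measurable one, namely
the process stopped at the time `T`. -/
lemma exists_jointly_stronglyMeasurable {E : Type*} [TopologicalSpace E] {𝓕 : Filtration ℝ≥0 mΩ}
    {α : ℝ≥0 → Ω → E} (hα : IsStronglyProgressive 𝓕 α) (T : ℝ) :
    ∃ f : Ω × ℝ → E, StronglyMeasurable f ∧
      ∀ ω, ∀ s ∈ Set.Ioc 0 T, α s.toNNReal ω = f (ω, s) := by
  refine ⟨fun p => α (min p.2.toNNReal T.toNNReal) p.1, ?_, fun ω s hs => ?_⟩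
  · have hu : StronglyMeasurable fun p : Set.Iic T.toNNReal × Ω => α p.1 p.2 :=
      (hα T.toNNReal).mono (sup_le_sup le_rfl (MeasurableSpace.comap_mono (𝓕.le _)))
    have hφ : Measurable fun p : Ω × ℝ =>
        ((⟨min p.2.toNNReal T.toNNReal, Set.mem_Iic.2 (min_le_right _ _)⟩, p.1) :
          Set.Iic T.toNNReal × Ω) :=
      ((measurable_snd.real_toNNReal.min measurable_const).subtype_mk).prodMk measurable_fst
    exact hu.comp_measurable hφ
  · dsimp only
    rw [min_eq_left (Real.toNNReal_le_toNNReal hs.2)]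

variable {E F : Type*} [TopologicalSpace E] [TopologicalSpace.PseudoMetrizableSpace E]
  [MeasurableSpace E] [BorelSpace E] [NormedAddCommGroup F] [MeasurableSpace F] [BorelSpace F]
  [SecondCountableTopology F] {𝓕 : Filtration ℝ≥0 mΩ} {α : ℝ≥0 → Ω → E} {φ : E → F}

lemma aestronglyMeasurable_comp_control (hα : IsStronglyProgressive 𝓕 α) (hφ : Measurable φ)
    (T : ℝ) (ω : Ω) :
    AEStronglyMeasurable (fun s : ℝ => φ (α s.toNNReal ω)) ((dE D ω).restrict (Set.Ioc 0 T)) := by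
  obtain ⟨f, hf, hαf⟩ := exists_jointly_stronglyMeasurable hα T
  refine ⟨fun s => φ (f (ω, s)),
    ((hφ.comp hf.measurable).comp measurable_prodMk_left).stronglyMeasurable, ?_⟩
  filter_upwards [ae_restrict_mem measurableSet_Ioc] with s hs
  rw [hαf ω s hs]

omit [SecondCountableTopology F] in
lemma IsStableSubordinator.aemeasurable_setLIntegral_dE (hD : IsStableSubordinator β D P)
    (hα : IsStronglyProgressive 𝓕 α) (hφ : Measurable φ) (T : ℝ) :
    AEMeasurable (fun ω => ∫⁻ s in Set.Ioc 0 T, ‖φ (α s.toNNReal ω)‖ₑ ∂(dE D ω)) P := by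
  obtain ⟨f, hf, hαf⟩ := exists_jointly_stronglyMeasurable hα T
  obtain ⟨κ, hκ, hκD⟩ := hD.exists_kernel T
  refine ⟨fun ω => ∫⁻ s, ‖φ (f (ω, s))‖ₑ ∂(κ ω),
    (hφ.comp hf.measurable).enorm.lintegral_kernel_prod_right', ?_⟩
  filter_upwards [hκD] with ω hω
  rw [hω]
  exact setLIntegral_congr_fun measurableSet_Ioc fun s hs => by simp only [hαf ω s hs]

lemma IsStableSubordinator.aestronglyMeasurable_setIntegral_dE [NormedSpace ℝ F]
    (hD : IsStableSubordinator β D P)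
    (hα : IsStronglyProgressive 𝓕 α) (hφ : Measurable φ) (T : ℝ) :
    AEStronglyMeasurable (fun ω => ∫ s in Set.Ioc 0 T, φ (α s.toNNReal ω) ∂(dE D ω)) P := by
  obtain ⟨f, hf, hαf⟩ := exists_jointly_stronglyMeasurable hα T
  obtain ⟨κ, hκ, hκD⟩ := hD.exists_kernel T
  refine ⟨fun ω => ∫ s, φ (f (ω, s)) ∂(κ ω),
    ((hφ.comp hf.measurable).stronglyMeasurable).integral_kernel_prod_right', ?_⟩
  filter_upwards [hκD] with ω hω
  rw [hω]
  exact setIntegral_congr_fun measurableSet_Ioc fun s hs => by simp only [hαf ω s hs]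

end Measurability

/-! ### Comparison of costs -/

section Cost

variable {Ω : Type*} {mΩ : MeasurableSpace Ω} {P : Measure Ω} [IsProbabilityMeasure P] {β : ℝ}
  {D : ℝ≥0 → Ω → ℝ} {𝓕 : Filtration ℝ≥0 mΩ} {d : ℕ} {L g : EuclideanSpace ℝ (Fin d) → ℝ}
  {α : ℝ≥0 → Ω → EuclideanSpace ℝ (Fin d)} {t t' : ℝ} {x x' : EuclideanSpace ℝ (Fin d)}

lemma FiniteCost.ae_integrableOn (hD : IsStableSubordinator β D P)
    (hα : IsStronglyProgressive 𝓕 α) (hL : Measurable L) (hfin : FiniteCost D P L t α) :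
    ∀ᵐ ω ∂P, IntegrableOn (fun s : ℝ => L (α s.toNNReal ω)) (Set.Ioc 0 t) (dE D ω) := by
  filter_upwards [ae_lt_top' (hD.aemeasurable_setLIntegral_dE hα hL t) hfin.ne] with ω hω
  exact ⟨aestronglyMeasurable_comp_control hα hL t ω, hω⟩

lemma FiniteCost.ae_integrableOn_control (hD : IsStableSubordinator β D P)
    (hα : IsStronglyProgressive 𝓕 α) (hL : Measurable L) {C : ℝ} (hC : ∀ q, ‖q‖ - C ≤ L q)
    (hfin : FiniteCost D P L t α) :
    ∀ᵐ ω ∂P, IntegrableOn (fun s : ℝ => α s.toNNReal ω) (Set.Ioc 0 t) (dE D ω) := by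
  filter_upwards [hfin.ae_integrableOn hD hα hL, hD.ae_isGoodPath] with ω hω hgood
  have := hgood.isFiniteMeasure_restrict 0 t
  refine (Integrable.add hω (integrable_const C)).mono'
    (aestronglyMeasurable_comp_control hα measurable_id t ω) (ae_of_all _ fun s => ?_)
  have := hC (α s.toNNReal ω)
  simp only [Pi.add_apply]
  linarith

lemma FiniteCost.integrable_running (hD : IsStableSubordinator β D P)
    (hα : IsStronglyProgressive 𝓕 α) (hL : Measurable L) (hfin : FiniteCost D P L t α) :
    Integrable (fun ω => ∫ s in Set.Ioc 0 t, L (α s.toNNReal ω) ∂(dE D ω)) P :=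
  ⟨hD.aestronglyMeasurable_setIntegral_dE hα hL t,
    (lintegral_mono fun _ => enorm_integral_le_lintegral_enorm _).trans_lt hfin⟩

lemma integrable_terminal (hD : IsStableSubordinator β D P) (hα : IsStronglyProgressive 𝓕 α)
    (hg : Continuous g) (hgb : ∃ M : ℝ, ∀ x, |g x| ≤ M) (x : EuclideanSpace ℝ (Fin d)) (t : ℝ) :
    Integrable (fun ω => g (state D x t α 0 ω)) P := by
  obtain ⟨M, hM⟩ := hgb
  exact Integrable.of_bound (hg.comp_aestronglyMeasurable (aestronglyMeasurable_const.sub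
    (hD.aestronglyMeasurable_setIntegral_dE hα measurable_id t))) M (ae_of_all _ fun ω => hM _)

lemma FiniteCost.integrable_cost (hD : IsStableSubordinator β D P)
    (hα : IsStronglyProgressive 𝓕 α) (hL : Measurable L) (hg : Continuous g)
    (hgb : ∃ M : ℝ, ∀ x, |g x| ≤ M) (hfin : FiniteCost D P L t α)
    (x : EuclideanSpace ℝ (Fin d)) :
    Integrable (fun ω => (∫ s in Set.Ioc 0 t, L (α s.toNNReal ω) ∂(dE D ω)) +
      g (state D x t α 0 ω)) P :=
  (hfin.integrable_running hD hα hL).add (integrable_terminal hD hα hg hgb x t)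

lemma cost_le_cost_add (hD : IsStableSubordinator β D P)
    (hα : IsStronglyProgressive 𝓕 α) (hL : Measurable L) {Lg : ℝ≥0} (hg : LipschitzWith Lg g)
    (hgb : ∃ M : ℝ, ∀ x, |g x| ≤ M) (hfin : FiniteCost D P L t α) :
    cost D P L g x t α ≤ cost D P L g x' t α + Lg * ‖x - x'‖ := by
  have hi := hfin.integrable_cost hD hα hL hg.continuous hgb
  have hconst : Lg * ‖x - x'‖ = ∫ _, (Lg : ℝ) * ‖x - x'‖ ∂P := by simp
  rw [cost, cost, hconst, ← integral_add (hi x') (integrable_const _)]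
  refine integral_mono (hi x) ((hi x').add (integrable_const _)) fun ω => ?_
  have h1 := hg.dist_le_mul (state D x t α 0 ω) (state D x' t α 0 ω)
  rw [Real.dist_eq, dist_eq_norm] at h1
  have h2 : state D x t α 0 ω - state D x' t α 0 ω = x - x' := by simp [state]
  rw [h2] at h1
  dsimp only
  linarith [le_abs_self (g (state D x t α 0 ω) - g (state D x' t α 0 ω))]

omit [IsProbabilityMeasure P] in
lemma FiniteCost.mono (hfin : FiniteCost D P L t α) (htt' : t' ≤ t) : FiniteCost D P L t' α :=
  (lintegral_mono fun _ => lintegral_mono_set (Set.Ioc_subset_Ioc_right htt')).trans_lt hfin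

/-- Dropping the part of a control after `t'` saves at most a multiple of the expected clock
increment: by superlinearity, the running cost on `(t', t]` pays for the displacement of the
terminal state, whose effect on `g` is at most `Lg` times the length of the path. -/
lemma FiniteCost.cost_restrict_le (hD : IsStableSubordinator β D P)
    (hα : IsStronglyProgressive 𝓕 α) (hL : Measurable L) {Lg : ℝ≥0} (hg : LipschitzWith Lg g)
    (hgb : ∃ M : ℝ, ∀ x, |g x| ≤ M) {C₁ : ℝ} (hC₁ : ∀ q, ‖q‖ - C₁ ≤ L q)
    {C : ℝ} (hC : ∀ q, Lg * ‖q‖ - C ≤ L q)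
    (ht' : 0 ≤ t') (htt' : t' ≤ t) (hfin : FiniteCost D P L t α) :
    cost D P L g x t' α ≤
      cost D P L g x t α + C * ∫ ω, (inverse D t ω - inverse D t' ω) ∂P := by
  have hi := hfin.integrable_cost hD hα hL hg.continuous hgb x
  have hi' := (hfin.mono htt').integrable_cost hD hα hL hg.continuous hgb x
  have hE : Integrable (fun ω => C * (inverse D t ω - inverse D t' ω)) P :=
    ((hD.integrable_inverse t).sub (hD.integrable_inverse t')).const_mul C
  rw [cost, cost, ← integral_const_mul, ← integral_add hi hE]
  refine integral_mono_ae hi' (hi.add hE) ?_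
  filter_upwards [hfin.ae_integrableOn hD hα hL, hfin.ae_integrableOn_control hD hα hL hC₁,
    hD.ae_isGoodPath] with ω hLi hαi hgood
  have hunion : Set.Ioc 0 t = Set.Ioc 0 t' ∪ Set.Ioc t' t :=
    (Set.Ioc_union_Ioc_eq_Ioc ht' htt').symm
  have hdisj : Disjoint (Set.Ioc 0 t') (Set.Ioc t' t) := Set.Ioc_disjoint_Ioc_of_le le_rfl
  have hsub : Set.Ioc 0 t' ⊆ Set.Ioc 0 t := Set.Ioc_subset_Ioc_right htt'
  have hsub' : Set.Ioc t' t ⊆ Set.Ioc 0 t := Set.Ioc_subset_Ioc_left ht'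
  have hLsplit : ∫ s in Set.Ioc 0 t, L (α s.toNNReal ω) ∂(dE D ω) =
      ∫ s in Set.Ioc 0 t', L (α s.toNNReal ω) ∂(dE D ω) +
        ∫ s in Set.Ioc t' t, L (α s.toNNReal ω) ∂(dE D ω) := by
    rw [hunion, setIntegral_union hdisj measurableSet_Ioc (hLi.mono_set hsub)
      (hLi.mono_set hsub')]
  have hαsplit : state D x t' α 0 ω - state D x t α 0 ω =
      ∫ s in Set.Ioc t' t, α s.toNNReal ω ∂(dE D ω) := by
    rw [state, state, hunion, setIntegral_union hdisj measurableSet_Ioc (hαi.mono_set hsub)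
      (hαi.mono_set hsub')]
    abel
  have hgle : g (state D x t' α 0 ω) - g (state D x t α 0 ω) ≤
      Lg * ∫ s in Set.Ioc t' t, ‖α s.toNNReal ω‖ ∂(dE D ω) := by
    have h1 := hg.dist_le_mul (state D x t' α 0 ω) (state D x t α 0 ω)
    rw [Real.dist_eq, dist_eq_norm, hαsplit] at h1
    exact (le_abs_self _).trans (h1.trans
      (mul_le_mul_of_nonneg_left (norm_integral_le_integral_norm _) Lg.2))
  have := hgood.isFiniteMeasure_restrict t' t
  have hrun : Lg * ∫ s in Set.Ioc t' t, ‖α s.toNNReal ω‖ ∂(dE D ω) -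
      C * (inverse D t ω - inverse D t' ω) ≤
        ∫ s in Set.Ioc t' t, L (α s.toNNReal ω) ∂(dE D ω) := by
    have hN : C * (inverse D t ω - inverse D t' ω) = ∫ _ in Set.Ioc t' t, C ∂(dE D ω) := by
      rw [setIntegral_const, hgood.real_dE_Ioc htt', smul_eq_mul, mul_comm]
    have hαn : IntegrableOn (fun s : ℝ => Lg * ‖α s.toNNReal ω‖) (Set.Ioc t' t) (dE D ω) :=
      (hαi.mono_set hsub').norm.const_mul _
    rw [hN, ← integral_const_mul, ← integral_sub hαn (integrable_const C)]
    exact integral_mono (hαn.sub (integrable_const C)) (hLi.mono_set hsub') fun s => hC _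
  rw [hLsplit]
  linarith

/-- The control that follows `α` up to and including the time `r` and vanishes afterwards. -/
noncomputable def extendByZero (r : ℝ≥0) (α : ℝ≥0 → Ω → EuclideanSpace ℝ (Fin d)) :
    ℝ≥0 → Ω → EuclideanSpace ℝ (Fin d) :=
  fun s ω => if s ≤ r then α s ω else 0

lemma isStronglyProgressive_extendByZero (hα : IsStronglyProgressive 𝓕 α) (r : ℝ≥0) :
    IsStronglyProgressive 𝓕 (extendByZero r α) := by
  intro i
  let _ : MeasurableSpace Ω := 𝓕 i
  have hs : MeasurableSet {p : Set.Iic i × Ω | (p.1 : ℝ≥0) ≤ r} :=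
    measurableSet_le (measurable_subtype_coe.comp measurable_fst) measurable_const
  exact StronglyMeasurable.ite hs (hα i) stronglyMeasurable_const

lemma extendByZero_of_mem {r : ℝ} {s : ℝ} (hs : s ∈ Set.Ioc 0 r) (ω : Ω) :
    extendByZero r.toNNReal α s.toNNReal ω = α s.toNNReal ω :=
  if_pos (Real.toNNReal_le_toNNReal hs.2)

lemma extendByZero_of_lt {r : ℝ} (hr : 0 ≤ r) {s : ℝ} (hs : s ∈ Set.Ioc r t) (ω : Ω) :
    extendByZero r.toNNReal α s.toNNReal ω = 0 :=
  if_neg (not_le.2 ((Real.toNNReal_lt_toNNReal_iff (hr.trans_lt hs.1)).2 hs.1))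

lemma FiniteCost.finiteCost_extendByZero (hD : IsStableSubordinator β D P)
    (ht' : 0 ≤ t') (htt' : t' ≤ t) (hfin : FiniteCost D P L t' α) :
    FiniteCost D P L t (extendByZero t'.toNNReal α) := by
  have hE : Integrable (fun ω => inverse D t ω - inverse D t' ω) P :=
    (hD.integrable_inverse t).sub (hD.integrable_inverse t')
  have heq : ∀ᵐ ω ∂P,
      ∫⁻ s in Set.Ioc 0 t, ‖L (extendByZero t'.toNNReal α s.toNNReal ω)‖ₑ ∂(dE D ω) =
        ∫⁻ s in Set.Ioc 0 t', ‖L (α s.toNNReal ω)‖ₑ ∂(dE D ω) +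
          ‖L 0‖ₑ * ENNReal.ofReal (inverse D t ω - inverse D t' ω) := by
    filter_upwards [hD.ae_isGoodPath] with ω hgood
    rw [← Set.Ioc_union_Ioc_eq_Ioc ht' htt',
      lintegral_union measurableSet_Ioc (Set.Ioc_disjoint_Ioc_of_le le_rfl)]
    congr 1
    · exact setLIntegral_congr_fun measurableSet_Ioc fun s hs => by
        simp only [extendByZero_of_mem hs]
    · rw [← hgood.dE_Ioc, ← setLIntegral_const]
      exact setLIntegral_congr_fun measurableSet_Ioc fun s hs => by
        simp only [extendByZero_of_lt ht' hs]
  rw [FiniteCost, lintegral_congr_ae heq,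
    lintegral_add_right' _ (hE.aemeasurable.ennreal_ofReal.const_mul _),
    lintegral_const_mul'' _ hE.aemeasurable.ennreal_ofReal]
  exact ENNReal.add_lt_top.2 ⟨hfin, ENNReal.mul_lt_top enorm_lt_top hE.lintegral_lt_top⟩

/-- Extending a control by `0` does not move the terminal state, so that only the running cost
`L 0` of standing still is added. -/
lemma FiniteCost.cost_extendByZero (hD : IsStableSubordinator β D P)
    (hα : IsStronglyProgressive 𝓕 α) (hL : Measurable L) (hg : Continuous g)
    (hgb : ∃ M : ℝ, ∀ x, |g x| ≤ M) {C₁ : ℝ} (hC₁ : ∀ q, ‖q‖ - C₁ ≤ L q)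
    (ht' : 0 ≤ t') (htt' : t' ≤ t) (hfin : FiniteCost D P L t' α) :
    cost D P L g x t (extendByZero t'.toNNReal α) =
      cost D P L g x t' α + L 0 * ∫ ω, (inverse D t ω - inverse D t' ω) ∂P := by
  have hi := hfin.integrable_cost hD hα hL hg hgb x
  have hE : Integrable (fun ω => L 0 * (inverse D t ω - inverse D t' ω)) P :=
    ((hD.integrable_inverse t).sub (hD.integrable_inverse t')).const_mul _
  have hfin' := hfin.finiteCost_extendByZero hD ht' htt'
  have hα' := isStronglyProgressive_extendByZero hα t'.toNNReal
  rw [cost, cost, ← integral_const_mul, ← integral_add hi hE]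
  refine integral_congr_ae ?_
  filter_upwards [hfin'.ae_integrableOn hD hα' hL,
    hfin'.ae_integrableOn_control hD hα' hL hC₁, hD.ae_isGoodPath] with ω hLi hαi hgood
  have hunion : Set.Ioc 0 t = Set.Ioc 0 t' ∪ Set.Ioc t' t :=
    (Set.Ioc_union_Ioc_eq_Ioc ht' htt').symm
  have hdisj : Disjoint (Set.Ioc 0 t') (Set.Ioc t' t) := Set.Ioc_disjoint_Ioc_of_le le_rfl
  have hsub : Set.Ioc 0 t' ⊆ Set.Ioc 0 t := Set.Ioc_subset_Ioc_right htt'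
  have hsub' : Set.Ioc t' t ⊆ Set.Ioc 0 t := Set.Ioc_subset_Ioc_left ht'
  have hrun : ∫ s in Set.Ioc 0 t, L (extendByZero t'.toNNReal α s.toNNReal ω) ∂(dE D ω) =
      ∫ s in Set.Ioc 0 t', L (α s.toNNReal ω) ∂(dE D ω) +
        L 0 * (inverse D t ω - inverse D t' ω) := by
    rw [hunion, setIntegral_union hdisj measurableSet_Ioc (hLi.mono_set hsub)
      (hLi.mono_set hsub')]
    congr 1
    · exact setIntegral_congr_fun measurableSet_Ioc fun s hs => by
        simp only [extendByZero_of_mem hs]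
    · rw [← hgood.real_dE_Ioc htt', mul_comm, ← smul_eq_mul, ← setIntegral_const]
      exact setIntegral_congr_fun measurableSet_Ioc fun s hs => by
        simp only [extendByZero_of_lt ht' hs]
  have hstate : state D x t (extendByZero t'.toNNReal α) 0 ω = state D x t' α 0 ω := by
    rw [state, state, hunion, setIntegral_union hdisj measurableSet_Ioc (hαi.mono_set hsub)
      (hαi.mono_set hsub')]
    have h1 : ∫ s in Set.Ioc 0 t', extendByZero t'.toNNReal α s.toNNReal ω ∂(dE D ω) =
        ∫ s in Set.Ioc 0 t', α s.toNNReal ω ∂(dE D ω) :=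
      setIntegral_congr_fun measurableSet_Ioc fun s hs => extendByZero_of_mem hs ω
    have h2 : ∫ s in Set.Ioc t' t, extendByZero t'.toNNReal α s.toNNReal ω ∂(dE D ω) = 0 :=
      setIntegral_eq_zero_of_forall_eq_zero fun s hs => extendByZero_of_lt ht' hs ω
    rw [h1, h2, add_zero]
  rw [hrun, hstate]
  ring

omit [IsProbabilityMeasure P] in
lemma finiteCost_zero : FiniteCost D P L 0 α := by simp [FiniteCost]

lemma cost_zero : cost D P L g x 0 α = g x := by simp [cost, state]

end Cost

/-! ### The value function -/

section Value

variable {Ω : Type*} {mΩ : MeasurableSpace Ω} {P : Measure Ω} [IsProbabilityMeasure P] {β : ℝ}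
  {D : ℝ≥0 → Ω → ℝ} {𝓕 : Filtration ℝ≥0 mΩ} {d : ℕ} {H g : EuclideanSpace ℝ (Fin d) → ℝ}
  {t t' : ℝ} {x : EuclideanSpace ℝ (Fin d)}

/-- With no time left every control costs `g x`, as `P` is a probability measure. -/
lemma costSet_zero : costSet D P 𝓕 H g x 0 = {g x} := by
  ext c
  constructor
  · rintro ⟨α, -, -, rfl⟩
    exact cost_zero
  · rintro rfl
    exact ⟨fun _ _ => 0, isStronglyProgressive_const 𝓕 0, finiteCost_zero, cost_zero.symm⟩

lemma valueFunction_zero : valueFunction D P 𝓕 H g x 0 = g x := by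
  rw [valueFunction, costSet_zero, csInf_singleton]

end Value

end FracHJ

theorem mainTheorem2 {Ω : Type*} {mΩ : MeasurableSpace Ω} (P : Measure Ω) [IsProbabilityMeasure P]
    (β : ℝ) (hβ0 : 0 < β) (hβ1 : β < 1)
    (D : ℝ≥0 → Ω → ℝ) (hD : FracHJ.IsStableSubordinator β D P)
    (𝓕 : Filtration ℝ≥0 mΩ)
    (d : ℕ) (H g : EuclideanSpace ℝ (Fin d) → ℝ)
    (hHconv : ConvexOn ℝ Set.univ H)
    (hHsup : Tendsto (fun p => H p / ‖p‖) (Bornology.cobounded (EuclideanSpace ℝ (Fin d))) atTop)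
    (Lg : ℝ≥0) (hgLip : LipschitzWith Lg g) (hgbdd : ∃ M : ℝ, ∀ x, |g x| ≤ M) :
    (∀ x t, 0 < t →
      IsGLB (FracHJ.costSet D P 𝓕 H g x t) (FracHJ.valueFunction D P 𝓕 H g x t)) ∧
    (∀ x x' t, 0 < t →
      |FracHJ.valueFunction D P 𝓕 H g x t - FracHJ.valueFunction D P 𝓕 H g x' t|
        ≤ Lg * ‖x - x'‖) ∧
    (∃ C : ℝ, ∀ x t, 0 < t → |FracHJ.valueFunction D P 𝓕 H g x t - g x| ≤ C * t ^ β) ∧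
    (∃ C : ℝ, ∀ x t t', 0 < t' → t' < t →
      |FracHJ.valueFunction D P 𝓕 H g x t - FracHJ.valueFunction D P 𝓕 H g x t'|
        ≤ C * (t - t') ^ β) := by
  have hL := FracHJ.measurable_legendre hHconv hHsup
  obtain ⟨C₁, -, hC₁⟩ := FracHJ.exists_le_legendre hHconv hHsup 1 zero_le_one
  simp only [one_mul] at hC₁
  obtain ⟨C, hC0, hC⟩ := FracHJ.exists_le_legendre hHconv hHsup Lg Lg.2
  set m : ℝ := ∫ ω, FracHJ.inverse D 1 ω ∂P
  have hm : 0 ≤ m := integral_nonneg fun ω => FracHJ.inverse_nonneg 1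
  -- Restricting and extending controls compares the two cost sets.
  have hrestrict : ∀ x t t', 0 ≤ t' → t' < t → ∀ c ∈ FracHJ.costSet D P 𝓕 H g x t,
      ∃ c' ∈ FracHJ.costSet D P 𝓕 H g x t', c' ≤ c + C * (m * (t - t') ^ β) := by
    rintro x t t' ht' htt' c ⟨α, hα, hfin, rfl⟩
    exact ⟨_, ⟨α, hα, hfin.mono htt'.le, rfl⟩,
      (hfin.cost_restrict_le hD hα hL hgLip hgbdd hC₁ hC ht' htt'.le).trans <| by
        gcongr; exact hD.integral_inverse_sub_le hβ0 hβ1 ht' htt'⟩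
  have hextend : ∀ x t t', 0 ≤ t' → t' < t → ∀ c ∈ FracHJ.costSet D P 𝓕 H g x t',
      ∃ c' ∈ FracHJ.costSet D P 𝓕 H g x t,
        c' ≤ c + |FracHJ.legendre H 0| * (m * (t - t') ^ β) := by
    rintro x t t' ht' htt' c ⟨α, hα, hfin, rfl⟩
    refine ⟨_, ⟨_, FracHJ.isStronglyProgressive_extendByZero hα t'.toNNReal,
      hfin.finiteCost_extendByZero hD ht' htt'.le, rfl⟩, ?_⟩
    rw [hfin.cost_extendByZero hD hα hL hgLip.continuous hgbdd hC₁ ht' htt'.le]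
    have hnn : 0 ≤ ∫ ω, (FracHJ.inverse D t ω - FracHJ.inverse D t' ω) ∂P :=
      integral_nonneg_of_ae (hD.ae_isGoodPath.mono fun ω hω =>
        sub_nonneg.2 (hω.monotone_inverse htt'.le))
    gcongr
    · exact le_abs_self _
    · exact hD.integral_inverse_sub_le hβ0 hβ1 ht' htt'
  have hGLB : ∀ x t, 0 ≤ t →
      IsGLB (FracHJ.costSet D P 𝓕 H g x t) (FracHJ.valueFunction D P 𝓕 H g x t) := by
    intro x t ht
    rcases ht.eq_or_lt with rfl | ht
    · rw [FracHJ.valueFunction_zero, FracHJ.costSet_zero]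
      exact isGLB_singleton
    refine isGLB_csInf ?_ ?_
    · obtain ⟨c', hc', -⟩ := hextend x t 0 le_rfl ht (g x) (by simp [FracHJ.costSet_zero])
      exact ⟨c', hc'⟩
    · refine ⟨g x - C * (m * (t - 0) ^ β), fun c hc => ?_⟩
      obtain ⟨c', hc', hle⟩ := hrestrict x t 0 le_rfl ht c hc
      rw [FracHJ.costSet_zero, Set.mem_singleton_iff] at hc'
      linarith
  have hle_of : ∀ x x' t t' K, 0 ≤ t → 0 ≤ t' → (∀ c ∈ FracHJ.costSet D P 𝓕 H g x t,
      ∃ c' ∈ FracHJ.costSet D P 𝓕 H g x' t', c' ≤ c + K) →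
      FracHJ.valueFunction D P 𝓕 H g x' t' ≤ FracHJ.valueFunction D P 𝓕 H g x t + K := by
    intro x x' t t' K ht ht' h
    rw [← sub_le_iff_le_add]
    refine (hGLB x t ht).2 fun c hc => ?_
    obtain ⟨c', hc', hle⟩ := h c hc
    linarith [(hGLB x' t' ht').1 hc']
  -- The time regularity down to `t' = 0`, where the value function is `g`.
  have htime : ∀ x t t', 0 ≤ t' → t' < t →
      |FracHJ.valueFunction D P 𝓕 H g x t - FracHJ.valueFunction D P 𝓕 H g x t'|
        ≤ max C |FracHJ.legendre H 0| * m * (t - t') ^ β := by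
    intro x t t' ht' htt'
    have ht := ht'.trans htt'.le
    have hpow : 0 ≤ m * (t - t') ^ β :=
      mul_nonneg hm (Real.rpow_nonneg (sub_nonneg.2 htt'.le) β)
    have h1 := hle_of x x t t' _ ht ht' (hrestrict x t t' ht' htt')
    have h2 := hle_of x x t' t _ ht' ht (hextend x t t' ht' htt')
    have h3 := mul_le_mul_of_nonneg_right (le_max_left C |FracHJ.legendre H 0|) hpow
    have h4 := mul_le_mul_of_nonneg_right (le_max_right C |FracHJ.legendre H 0|) hpow
    rw [mul_assoc, abs_sub_le_iff]
    constructor <;> linarith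
  refine ⟨fun x t ht => hGLB x t ht.le, fun x x' t ht => ?_,
    ⟨max C |FracHJ.legendre H 0| * m, fun x t ht => ?_⟩,
    ⟨max C |FracHJ.legendre H 0| * m, fun x t t' ht' htt' => htime x t t' ht'.le htt'⟩⟩
  · have hspace : ∀ x x', FracHJ.valueFunction D P 𝓕 H g x t ≤
        FracHJ.valueFunction D P 𝓕 H g x' t + Lg * ‖x - x'‖ := fun x x' => by
      refine hle_of x' x t t _ ht.le ht.le ?_
      rintro c ⟨α, hα, hfin, rfl⟩
      exact ⟨_, ⟨α, hα, hfin, rfl⟩, FracHJ.cost_le_cost_add hD hα hL hgLip hgbdd hfin⟩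
    have h1 := hspace x x'
    have h2 := hspace x' x
    rw [norm_sub_rev x' x] at h2
    rw [abs_sub_le_iff]
    constructor <;> linarith
  · have h := htime x t 0 le_rfl ht
    rwa [FracHJ.valueFunction_zero, sub_zero] at h
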